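/- Let $d\ge 1$ and let $\langle\cdot,\cdot\rangle$ be the inner product of $L^2(\mathbb R^d)$, linear in the first argument. For $z=(x,\xi)\in\mathbb R^{2d}$ let $\pi(z)f(t)=e^{2\pi i\xi\cdot t}f(t-x)$. For $a,b>0$ and $g\in L^2(\mathbb R^d)$ write $\Lambda=a\mathbb Z^d\times b\mathbb Z^d$; the Gabor system $\mathcal G(g,\Lambda)=\{\pi(\lambda)g:\lambda\in\Lambda\}$ is a frame if there are $A,B>0$ with $A\|f\|^2\le\sum_{\lambda\in\Lambda}|\langle f,\pi(\lambda)g\rangle|^2\le B\|f\|^2$ for all $f\in L^2(\mathbb R^d)$. For a tempered distribution $\sigma$ on $\mathbb R^{2d}$, the Kohn–Nirenberg operator $\sigma^{KN}$ from $\mathcal S(\mathbb R^d)$ to $\mathcal S'(\mathbb R^d)$ is defined by $\langle\sigma^{KN}f,h\rangle=\langle\sigma,R(h,f)\rangle$ for $f,h\in\mathcal S(\mathbb R^d)$, where $R(h,f)(x,\xi)=h(x)\overline{\hat f(\xi)}e^{-2\pi i x\cdot\xi}$, $\hat f(\xi)=\int f(x)e^{-2\pi i\xi\cdot x}\,dx$,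 and pairings of distributions with test functions are conjugate-linear in the test function. **Theorem.** Let $\sigma^{KN}$ be bounded on $L^2(\mathbb R^d)$, that is, let it extend to a bounded operator on $L^2(\mathbb R^d)$, again denoted $\sigma^{KN}$. Let $a,b>0$ with $ab<1$, and let $g\in L^2(\mathbb R^d)$ be such that $\mathcal G(g,a\mathbb Z^d\times b\mathbb Z^d)$ is a frame for $L^2(\mathbb R^d)$. If the channel matrix is diagonal, that is, if $\langle\sigma^{KN}\pi(\mu)g,\pi(\lambda)g\rangle=0$ for all $\lambda,\mu\in a\mathbb Z^d\times b\mathbb Z^d$ with $\lambda\ne\mu$, then $\sigma^{KN}=0$. -/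

import Mathlib

noncomputable section

open MeasureTheory SchwartzMap FourierTransform

namespace Gabor

/-- The Euclidean space `ℝ^d`. -/
abbrev E (d : ℕ) : Type := EuclideanSpace ℝ (Fin d)

/-- The Hilbert space `L²(ℝ^d)` of complex-valued functions. -/
abbrev L2 (d : ℕ) : Type := Lp ℂ 2 (volume : Measure (E d))

variable {d : ℕ}

/-! ### Symbols and the Kohn-Nirenberg calculus -/

/-- The tensor product `(x, ξ) ↦ u x * v ξ` of two Schwartz functions is a Schwartz function. -/
def tensor (u v : 𝓢(E d, ℂ)) : 𝓢(E d × E d, ℂ) where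
  toFun p := u p.1 * v p.2
  smooth' := (u.smooth'.comp contDiff_fst).mul (v.smooth'.comp contDiff_snd)
  decay' k n := by
    choose A hA using fun k n => u.decay' k n
    choose B hB using fun k n => v.decay' k n
    have hu : ContDiff ℝ n (fun p : E d × E d => u p.1) := (u.smooth n).comp contDiff_fst
    have hv : ContDiff ℝ n (fun p : E d × E d => v p.2) := (v.smooth n).comp contDiff_snd
    have hu' : ∀ i ≤ n, ∀ p : E d × E d,
        ‖iteratedFDeriv ℝ i (fun p : E d × E d => u p.1) p‖ ≤ ‖iteratedFDeriv ℝ i u p.1‖ := by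
      intro i _ p
      have h := (ContinuousLinearMap.fst ℝ (E d) (E d)).iteratedFDeriv_comp_right
        (f := (u : E d → ℂ)) (n := i) (u.smooth i) p (i := i) le_rfl
      change ‖iteratedFDeriv ℝ i ((u : E d → ℂ) ∘ (ContinuousLinearMap.fst ℝ (E d) (E d))) p‖ ≤ _
      rw [h]
      refine (ContinuousMultilinearMap.norm_compContinuousLinearMap_le _ _).trans ?_
      refine mul_le_of_le_one_right (norm_nonneg _) ?_
      exact Finset.prod_le_one (fun _ _ => norm_nonneg _)
        (fun _ _ => ContinuousLinearMap.norm_fst_le ℝ (E d) (E d))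
    have hv' : ∀ i ≤ n, ∀ p : E d × E d,
        ‖iteratedFDeriv ℝ i (fun p : E d × E d => v p.2) p‖ ≤ ‖iteratedFDeriv ℝ i v p.2‖ := by
      intro i _ p
      have h := (ContinuousLinearMap.snd ℝ (E d) (E d)).iteratedFDeriv_comp_right
        (f := (v : E d → ℂ)) (n := i) (v.smooth i) p (i := i) le_rfl
      change ‖iteratedFDeriv ℝ i ((v : E d → ℂ) ∘ (ContinuousLinearMap.snd ℝ (E d) (E d))) p‖ ≤ _
      rw [h]
      refine (ContinuousMultilinearMap.norm_compContinuousLinearMap_le _ _).trans ?_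
      refine mul_le_of_le_one_right (norm_nonneg _) ?_
      exact Finset.prod_le_one (fun _ _ => norm_nonneg _)
        (fun _ _ => ContinuousLinearMap.norm_snd_le ℝ (E d) (E d))
    refine ⟨∑ i ∈ Finset.range (n + 1),
      (n.choose i : ℝ) * (A k i * B 0 (n - i) + A 0 i * B k (n - i)), fun p => ?_⟩
    have h1 := norm_iteratedFDeriv_mul_le (𝕜 := ℝ) hu hv p (n := n) le_rfl
    refine (mul_le_mul_of_nonneg_left h1 (by positivity)).trans ?_
    rw [Finset.mul_sum]
    refine Finset.sum_le_sum fun i hi => ?_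
    have hi' : i ≤ n := Nat.lt_succ_iff.mp (Finset.mem_range.mp hi)
    have a := hu' i hi' p
    have b := hv' (n - i) (Nat.sub_le _ _) p
    have hk : ‖p‖ ^ k ≤ ‖p.1‖ ^ k + ‖p.2‖ ^ k := by
      rw [Prod.norm_def]
      rcases max_cases ‖p.1‖ ‖p.2‖ with h | h <;> rw [h.1]
      · exact le_add_of_nonneg_right (by positivity)
      · exact le_add_of_nonneg_left (by positivity)
    have a0 : ‖iteratedFDeriv ℝ i u p.1‖ ≤ A 0 i := by
      have := hA 0 i p.1
      rwa [pow_zero, one_mul] at this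
    have b0 : ‖iteratedFDeriv ℝ (n - i) v p.2‖ ≤ B 0 (n - i) := by
      have := hB 0 (n - i) p.2
      rwa [pow_zero, one_mul] at this
    have ak : ‖p.1‖ ^ k * ‖iteratedFDeriv ℝ i u p.1‖ ≤ A k i := hA k i p.1
    have bk : ‖p.2‖ ^ k * ‖iteratedFDeriv ℝ (n - i) v p.2‖ ≤ B k (n - i) := hB k (n - i) p.2
    calc ‖p‖ ^ k * ((n.choose i : ℝ) * ‖iteratedFDeriv ℝ i (fun p : E d × E d => u p.1) p‖ *
          ‖iteratedFDeriv ℝ (n - i) (fun p : E d × E d => v p.2) p‖)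
        ≤ (‖p.1‖ ^ k + ‖p.2‖ ^ k) * ((n.choose i : ℝ) * ‖iteratedFDeriv ℝ i u p.1‖ *
          ‖iteratedFDeriv ℝ (n - i) v p.2‖) := by gcongr
      _ = (n.choose i : ℝ) * ((‖p.1‖ ^ k * ‖iteratedFDeriv ℝ i u p.1‖) *
            ‖iteratedFDeriv ℝ (n - i) v p.2‖ +
            ‖iteratedFDeriv ℝ i u p.1‖ * (‖p.2‖ ^ k * ‖iteratedFDeriv ℝ (n - i) v p.2‖)) := by
          ring
      _ ≤ _ := by
          have hA0 : 0 ≤ A 0 i := (norm_nonneg _).trans a0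
          have hAk : 0 ≤ A k i := le_trans (by positivity) ak
          gcongr

/-- The phase factor `(x, ξ) ↦ e^{-2πi x·ξ}`. -/
def phase (p : E d × E d) : ℂ := Complex.exp (-(2 * Real.pi * Complex.I) * (inner ℝ p.1 p.2 : ℝ))

/-- Multiplication by `phase` preserves Schwartz functions. -/
theorem hasTemperateGrowth_phase : (phase (d := d)).HasTemperateGrowth := by
  have h1 : (fun p : E d × E d => (inner ℝ p.1 p.2 : ℝ)).HasTemperateGrowth := by
    exact (innerSL ℝ (E := E d)).bilinear_hasTemperateGrowth
      (ContinuousLinearMap.fst ℝ (E d) (E d)).hasTemperateGrowth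
      (ContinuousLinearMap.snd ℝ (E d) (E d)).hasTemperateGrowth
  have h2 : (fun t : ℝ => Complex.exp (-(2 * Real.pi * Complex.I) * t)).HasTemperateGrowth := by
    set c : ℂ := -(2 * Real.pi * Complex.I) with hc
    have hd : ∀ n : ℕ, iteratedDeriv n (fun t : ℝ => Complex.exp (c * t)) =
        fun t : ℝ => c ^ n * Complex.exp (c * t) := by
      intro n
      induction n with
      | zero => simp
      | succ n ih =>
        rw [iteratedDeriv_succ, ih]
        funext t
        have h := ((((hasDerivAt_id t).ofReal_comp).const_mul c).cexp).const_mul (c ^ n)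
        simp only [id] at h
        rw [h.deriv]
        push_cast
        ring
    refine ⟨(contDiff_const.mul Complex.ofRealCLM.contDiff).cexp, fun n => ⟨0, ‖c‖ ^ n, fun t => ?_⟩⟩
    rw [norm_iteratedFDeriv_eq_norm_iteratedDeriv, hd]
    have : ‖Complex.exp (c * t)‖ = 1 := by
      rw [Complex.norm_exp, hc]; simp
    simp [this]
  exact h2.comp h1

/-- Pointwise complex conjugation of a Schwartz function. -/
def conjS {F : Type*} [NormedAddCommGroup F] [NormedSpace ℝ F] (u : 𝓢(F, ℂ)) : 𝓢(F, ℂ) :=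
  u.postcompCLM (𝕜 := ℝ) (Complex.conjCLE : ℂ →L[ℝ] ℂ)

/-- The Rihaczek distribution `R(u, v)(x, ξ) = u x * conj (v̂ ξ) * e^{-2πi x·ξ}` of two Schwartz
functions, as a Schwartz function on `ℝ^{2d}`. -/
def rihaczek (u v : 𝓢(E d, ℂ)) : 𝓢(E d × E d, ℂ) :=
  smulLeftCLM ℂ phase (tensor u (conjS (𝓕 v)))

theorem rihaczek_apply (u v : 𝓢(E d, ℂ)) (x ξ : E d) :
    rihaczek u v (x, ξ) = u x * star (𝓕 (v : E d → ℂ) ξ) *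
      Complex.exp (-(2 * Real.pi * Complex.I) * (inner ℝ x ξ : ℝ)) := by
  rw [rihaczek, smulLeftCLM_apply_apply hasTemperateGrowth_phase, smul_eq_mul, mul_comm]
  rfl

/-- The form `⟨σ^{KN} f, h⟩ = ⟨σ, R(h, f)⟩` that defines the operator `σ^{KN}` from Schwartz
functions to tempered distributions. The pairing of a distribution with a test function is
conjugate-linear in the test function, extending `∫ σ(z) * conj (φ z) dz`. -/
def knForm (σ : 𝓢'(E d × E d, ℂ)) (f h : 𝓢(E d, ℂ)) : ℂ :=
  σ (conjS (rihaczek h f))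

/-- `σ^{KN}` is bounded on `L²(ℝ^d)` and `T` is the bounded operator on `L²(ℝ^d)` that it defines:
`⟨T f, h⟩ = ⟨σ^{KN} f, h⟩` for all Schwartz functions `f` and `h`. (Mathlib's `inner` is
conjugate-linear in its first argument.) -/
def IsKNOperator (σ : 𝓢'(E d × E d, ℂ)) (T : L2 d →L[ℂ] L2 d) : Prop :=
  ∀ f h : 𝓢(E d, ℂ), inner ℂ (h.toLp 2) (T (f.toLp 2)) = knForm σ f h

/-! ### Gabor systems -/

theorem memLp_tfShift (z : E d × E d) (f : L2 d) :
    MemLp (fun t : E d =>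
      Complex.exp (2 * Real.pi * Complex.I * (inner ℝ z.2 t : ℝ)) * f (t - z.1)) 2 volume := by
  have h : MemLp (fun t : E d => f (t - z.1)) 2 volume :=
    (Lp.memLp f).comp_measurePreserving (measurePreserving_sub_right volume z.1)
  refine h.of_le ((Continuous.aestronglyMeasurable (by fun_prop)).mul h.1) (ae_of_all _ fun t => ?_)
  have : ‖Complex.exp (2 * Real.pi * Complex.I * (inner ℝ z.2 t : ℝ))‖ = 1 := by
    rw [Complex.norm_exp]; simp
  rw [norm_mul, this, one_mul]

/-- The time-frequency shift `π(z) f (t) = e^{2πi ξ·t} f (t - x)`, `z = (x, ξ)`, on `L²(ℝ^d)`. -/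
def tfShift (z : E d × E d) (f : L2 d) : L2 d := (memLp_tfShift z f).toLp _

/-- The lattice `aℤ^d × bℤ^d` in `ℝ^{2d}`. -/
def lattice (d : ℕ) (a b : ℝ) : Set (E d × E d) :=
  {z | ∃ k l : Fin d → ℤ, ∀ i, z.1 i = a * k i ∧ z.2 i = b * l i}

/-- The Gabor system `{π(μ) g : μ ∈ aℤ^d × bℤ^d}` is a frame for `L²(ℝ^d)`. -/
def IsGaborFrame (a b : ℝ) (g : L2 d) : Prop :=
  ∃ A B : ℝ, 0 < A ∧ 0 < B ∧ ∀ f : L2 d,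
    Summable (fun μ : lattice d a b => ‖inner ℂ (tfShift (μ : E d × E d) g) f‖ ^ 2) ∧
    A * ‖f‖ ^ 2 ≤ ∑' μ : lattice d a b, ‖inner ℂ (tfShift (μ : E d × E d) g) f‖ ^ 2 ∧
    ∑' μ : lattice d a b, ‖inner ℂ (tfShift (μ : E d × E d) g) f‖ ^ 2 ≤ B * ‖f‖ ^ 2

/-- The channel matrix `H_{ν μ} = ⟨T π(μ) g, π(ν) g⟩`, with `ν, μ ∈ aℤ^d × bℤ^d`. -/
def channelMatrix (T : L2 d →L[ℂ] L2 d) (a b : ℝ) (g : L2 d) :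
    Matrix (lattice d a b) (lattice d a b) ℂ :=
  Matrix.of fun ν μ => inner ℂ (tfShift (ν : E d × E d) g) (T (tfShift (μ : E d × E d) g))

end Gabor

end

/-! Write `e p` for the Gabor frame vectors and `R` for the inverse frame operator. Expanding `e i`
in the frame and pairing with `T* e i` gives, for a diagonal matrix, `⟨e i, T e i⟩ = ⟨e i, T e i⟩ ⟨e
i, R e i⟩`, since only the `i`-th term survives. If `⟨e i, R e i⟩ ≠ 1`, the diagonal vanishes too,
and completeness of the frame forces `T = 0` (`eq_zero_of_frame_matrix_isDiag`).

For a Gabor frame `R` commutes with lattice shifts, so `⟨e i, R e i⟩` is `⟨R g, g⟩` for every `i`.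
This number is `(ab)^d < 1`, one of the Wexler–Raz relations (`inner_dual_window`): test the dual
expansion on the indicator of `(0, a]^d`, sum over modulations by Parseval on the larger cube `(0,
b⁻¹]^d`, then over translations by tiling. The result is `a^d = b^{-d} ⟨R g, g⟩`. -/

open MeasureTheory
open scoped InnerProductSpace ComplexConjugate

/-! ### Frames in Hilbert space and diagonal frame matrices -/

section Frame

variable {H : Type*} [NormedAddCommGroup H] [InnerProductSpace ℂ H]

/-- The analysis operator `f ↦ (⟪e i, f⟫)ᵢ` of a Bessel family `e`. -/
noncomputable def analysisOperator {ι : Type*} (e : ι → H) (B : ℝ)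
    (hs : ∀ f, Summable fun i => ‖⟪e i, f⟫_ℂ‖ ^ 2)
    (hB : ∀ f, ∑' i, ‖⟪e i, f⟫_ℂ‖ ^ 2 ≤ B * ‖f‖ ^ 2) : H →L[ℂ] lp (fun _ : ι => ℂ) 2 :=
  LinearMap.mkContinuous
    { toFun := fun f => ⟨fun i => ⟪e i, f⟫_ℂ, memℓp_gen (by simpa using hs f)⟩
      map_add' := fun f h => by ext i; exact inner_add_right _ _ _
      map_smul' := fun c f => by ext i; exact inner_smul_right _ _ _ }
    (√B) (fun f => by
      refine le_of_sq_le_sq ?_ (by positivity)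
      have h := lp.norm_rpow_eq_tsum (p := 2) (by norm_num)
        (⟨fun i => ⟪e i, f⟫_ℂ, memℓp_gen (by simpa using hs f)⟩ : lp (fun _ : ι => ℂ) 2)
      simp only [ENNReal.toReal_ofNat, Real.rpow_ofNat] at h
      refine (h.trans_le (hB f)).trans ?_
      rw [mul_pow]
      gcongr
      -- No sign of `B` is assumed; for `B ≤ 0` the bound holds because a square is nonnegative.
      rcases le_total 0 B with h0 | h0
      · exact (Real.sq_sqrt h0).ge
      · exact h0.trans (sq_nonneg _))

theorem analysisOperator_apply {ι : Type*} (e : ι → H) (B : ℝ)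
    (hs : ∀ f, Summable fun i => ‖⟪e i, f⟫_ℂ‖ ^ 2)
    (hB : ∀ f, ∑' i, ‖⟪e i, f⟫_ℂ‖ ^ 2 ≤ B * ‖f‖ ^ 2) (f : H) (i : ι) :
    analysisOperator e B hs hB f i = ⟪e i, f⟫_ℂ := rfl

theorem eq_zero_of_forall_inner_eq_zero {ι : Type*} {e : ι → H} {A : ℝ} (hA : 0 < A)
    (hA' : ∀ f, A * ‖f‖ ^ 2 ≤ ∑' i, ‖⟪e i, f⟫_ℂ‖ ^ 2) {f : H} (hf : ∀ i, ⟪e i, f⟫_ℂ = 0) :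
    f = 0 := by
  have h := hA' f
  simp only [hf, norm_zero, ne_eq, OfNat.ofNat_ne_zero, not_false_eq_true, zero_pow,
    tsum_zero] at h
  have : ‖f‖ ^ 2 ≤ 0 := by
    by_contra! h'
    exact absurd h (not_le.2 (mul_pos hA h'))
  simpa using le_antisymm this (sq_nonneg _)

/-- The frame operator `S` of a frame is invertible, and its inverse yields the dual expansion. -/
theorem exists_frameOperator [CompleteSpace H] {ι : Type*} (e : ι → H) {A B : ℝ} (hA : 0 < A)
    (hs : ∀ f, Summable fun i => ‖⟪e i, f⟫_ℂ‖ ^ 2)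
    (hA' : ∀ f, A * ‖f‖ ^ 2 ≤ ∑' i, ‖⟪e i, f⟫_ℂ‖ ^ 2)
    (hB : ∀ f, ∑' i, ‖⟪e i, f⟫_ℂ‖ ^ 2 ≤ B * ‖f‖ ^ 2) :
    ∃ S : (H →L[ℂ] H)ˣ,
      ∀ x y, HasSum (fun i => ⟪x, e i⟫_ℂ * ⟪e i, y⟫_ℂ) ⟪x, (S : H →L[ℂ] H) y⟫_ℂ := by
  set C := analysisOperator e B hs hB
  have hnorm : ∀ x, A * ‖x‖ ^ 2 ≤ ‖C x‖ ^ 2 := fun x => by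
    have h := lp.norm_rpow_eq_tsum (p := 2) (by norm_num) (C x)
    simp only [ENNReal.toReal_ofNat, Real.rpow_ofNat] at h
    exact (hA' x).trans_eq h.symm
  -- The lower frame bound makes `C* C` coercive, hence invertible.
  have hu : IsUnit (C.adjoint ∘L C) := by
    refine ContinuousLinearMap.isUnit_of_forall_le_norm_inner_map _ (c := ⟨A, hA.le⟩) hA
      fun x => ?_
    rw [ContinuousLinearMap.comp_apply, ContinuousLinearMap.adjoint_inner_left,
      inner_self_eq_norm_sq_to_K]
    simp only [norm_pow, RCLike.norm_ofReal, abs_norm]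
    exact (mul_comm _ _).trans_le (hnorm x)
  obtain ⟨S, hS⟩ := hu
  refine ⟨S, fun x y => ?_⟩
  rw [hS, ContinuousLinearMap.comp_apply, ContinuousLinearMap.adjoint_inner_right]
  refine (lp.hasSum_inner (C x) (C y)).congr_fun fun i => ?_
  simp [C, analysisOperator_apply, mul_comm]

/-- `S` is a sum of terms `e i ⊗ e i`, each insensitive to the phase of `e i`, so conjugation by `U`
only reorders the sum. -/
theorem frameOperator_commute {ι : Type*} {e : ι → H} {S : H →L[ℂ] H}
    (hS : ∀ x y, HasSum (fun i => ⟪x, e i⟫_ℂ * ⟪e i, y⟫_ℂ) ⟪x, S y⟫_ℂ)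
    {U : H → H} (hU : ∀ x y, ⟪U x, U y⟫_ℂ = ⟪x, y⟫_ℂ) (hsurj : Function.Surjective U)
    (τ : ι ≃ ι) (c : ι → ℂ) (hc : ∀ i, ‖c i‖ = 1) (hUe : ∀ i, U (e i) = c i • e (τ i)) (y : H) :
    S (U y) = U (S y) := by
  refine ext_inner_left ℂ fun v => ?_
  obtain ⟨x, rfl⟩ := hsurj v
  rw [hU]
  refine HasSum.unique ((Equiv.hasSum_iff τ).2 (hS (U x) (U y))) ((hS x y).congr_fun fun i => ?_)
  have h1 : c i * conj (c i) = 1 := by simp [RCLike.mul_conj, hc]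
  rw [← hU x, ← hU _ y, hUe, inner_smul_right, inner_smul_left]
  simp only [Function.comp]
  linear_combination (-(⟪U x, e (τ i)⟫_ℂ * ⟪e (τ i), U y⟫_ℂ)) * h1

/-- The inverse `R` of the frame operator of a frame `e` is symmetric, yields the dual expansion, and
commutes with every unitary map that permutes `e` up to phase factors. -/
theorem exists_inverse_frameOperator [CompleteSpace H] {ι : Type*} (e : ι → H) {A B : ℝ}
    (hA : 0 < A) (hs : ∀ f, Summable fun i => ‖⟪e i, f⟫_ℂ‖ ^ 2)
    (hA' : ∀ f, A * ‖f‖ ^ 2 ≤ ∑' i, ‖⟪e i, f⟫_ℂ‖ ^ 2)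
    (hB : ∀ f, ∑' i, ‖⟪e i, f⟫_ℂ‖ ^ 2 ≤ B * ‖f‖ ^ 2) :
    ∃ R : H →L[ℂ] H, (∀ x y, HasSum (fun i => ⟪x, e i⟫_ℂ * ⟪e i, R y⟫_ℂ) ⟪x, y⟫_ℂ) ∧
      (∀ x y, ⟪R x, y⟫_ℂ = ⟪x, R y⟫_ℂ) ∧
      ∀ U : H → H, (∀ x y, ⟪U x, U y⟫_ℂ = ⟪x, y⟫_ℂ) → Function.Surjective U →
        ∀ (τ : ι ≃ ι) (c : ι → ℂ), (∀ i, ‖c i‖ = 1) → (∀ i, U (e i) = c i • e (τ i)) →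
          ∀ y, R (U y) = U (R y) := by
  obtain ⟨S, hS⟩ := exists_frameOperator e hA hs hA' hB
  have hSR : ∀ x, (S : H →L[ℂ] H) ((↑S⁻¹ : H →L[ℂ] H) x) = x := fun x =>
    congrArg (fun f : H →L[ℂ] H => f x) S.mul_inv
  have hRS : ∀ x, (↑S⁻¹ : H →L[ℂ] H) ((S : H →L[ℂ] H) x) = x := fun x =>
    congrArg (fun f : H →L[ℂ] H => f x) S.inv_mul
  have hSsymm : ∀ x y, ⟪(S : H →L[ℂ] H) x, y⟫_ℂ = ⟪x, (S : H →L[ℂ] H) y⟫_ℂ := by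
    intro x y
    rw [← inner_conj_symm]
    refine HasSum.unique ((RCLike.hasSum_conj' ℂ).2 (hS y x)) ((hS x y).congr_fun fun p => ?_)
    simp [mul_comm]
  refine ⟨↑S⁻¹, fun x y => ?_, fun x y => ?_, fun U hU hsurj τ c hc hUe y => ?_⟩
  · simpa only [hSR] using hS x ((↑S⁻¹ : H →L[ℂ] H) y)
  · conv_lhs => rw [← hSR y, ← hSsymm, hSR]
  · have h := frameOperator_commute hS hU hsurj τ c hc hUe ((↑S⁻¹ : H →L[ℂ] H) y)
    rw [← hRS (U ((↑S⁻¹ : H →L[ℂ] H) y)), h, hSR]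

/-- An operator whose matrix with respect to a frame `e` is diagonal vanishes if no coefficient
`⟨e i, R e i⟩` of the dual expansion of `e i` equals `1`. -/
theorem eq_zero_of_frame_matrix_isDiag [CompleteSpace H] {ι : Type*} {e : ι → H} {A : ℝ}
    (hA : 0 < A) (hA' : ∀ f, A * ‖f‖ ^ 2 ≤ ∑' i, ‖⟪e i, f⟫_ℂ‖ ^ 2) {R : H → H}
    (hR : ∀ x y, HasSum (fun i => ⟪x, e i⟫_ℂ * ⟪e i, R y⟫_ℂ) ⟪x, y⟫_ℂ)
    (hne : ∀ i, ⟪e i, R (e i)⟫_ℂ ≠ 1) {T : H →L[ℂ] H}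
    (hT : ∀ i j, i ≠ j → ⟪e i, T (e j)⟫_ℂ = 0) : T = 0 := by
  have hzero : ∀ i j, ⟪e i, T (e j)⟫_ℂ = 0 := fun i j => by
    by_cases hij : i = j
    · subst hij
      -- The coefficients `⟨T* e i, e j⟩ = ⟨e i, T e j⟩` are matrix entries, so the expansion
      -- collapses to `j = i`.
      have h1 := hR (T.adjoint (e i)) (e i)
      simp only [ContinuousLinearMap.adjoint_inner_left] at h1
      have h2 := h1.unique (hasSum_single i fun j hj => by rw [hT i j hj.symm, zero_mul])
      by_contra h0
      exact hne i (mul_left_cancel₀ h0 (by rw [← h2, mul_one]))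
    · exact hT i j hij
  have hTe : ∀ j, T (e j) = 0 := fun j => eq_zero_of_forall_inner_eq_zero hA hA' fun i => hzero i j
  have hadj : ∀ x, T.adjoint x = 0 := fun x =>
    eq_zero_of_forall_inner_eq_zero hA hA' fun i => by
      rw [ContinuousLinearMap.adjoint_inner_right, hTe, inner_zero_left]
  ext1 x
  refine ext_inner_left ℂ fun y => ?_
  rw [← ContinuousLinearMap.adjoint_inner_left, hadj]
  simp

end Frame

/-! ### Time-frequency shifts -/

namespace Gabor

variable {d : ℕ}

/-- The character `t ↦ e^{2πi ξ·t}`. -/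
noncomputable def character (ξ t : E d) : ℂ :=
  Complex.exp (2 * Real.pi * Complex.I * (inner ℝ ξ t : ℝ))

theorem norm_character (ξ t : E d) : ‖character ξ t‖ = 1 := by
  rw [character, Complex.norm_exp]; simp

theorem character_add_left (ξ η t : E d) :
    character (ξ + η) t = character ξ t * character η t := by
  simp only [character, ← Complex.exp_add, inner_add_left]
  push_cast
  ring_nf

theorem character_sub_right (ξ s t : E d) :
    character ξ (s - t) = character ξ s * conj (character ξ t) := by
  rw [character, character, character, ← Complex.exp_conj, ← Complex.exp_add, inner_sub_right]
  simp only [map_mul, Complex.conj_I, Complex.conj_ofReal, map_ofNat]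
  push_cast
  ring_nf

theorem character_mul_conj (ξ t : E d) : character ξ t * conj (character ξ t) = 1 := by
  simp [RCLike.mul_conj, norm_character]

theorem coeFn_tfShift (z : E d × E d) (f : L2 d) :
    tfShift z f =ᵐ[volume] fun t => character z.2 t * f (t - z.1) :=
  (memLp_tfShift z f).coeFn_toLp

theorem inner_tfShift_tfShift (z : E d × E d) (f h : L2 d) :
    ⟪tfShift z f, tfShift z h⟫_ℂ = ⟪f, h⟫_ℂ := by
  rw [L2.inner_def, L2.inner_def, ← integral_sub_right_eq_self (fun t => ⟪f t, h t⟫_ℂ) z.1]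
  refine integral_congr_ae ?_
  filter_upwards [coeFn_tfShift z f, coeFn_tfShift z h] with t hf hh
  rw [hf, hh]
  simp only [RCLike.inner_apply, map_mul]
  linear_combination (h (t - z.1) * conj (f (t - z.1))) * character_mul_conj z.2 t

theorem tfShift_tfShift (z w : E d × E d) (f : L2 d) :
    tfShift z (tfShift w f) = conj (character w.2 z.1) • tfShift (z + w) f := by
  refine Lp.ext ?_
  filter_upwards [coeFn_tfShift z (tfShift w f), coeFn_tfShift (z + w) f,
    Lp.coeFn_smul (conj (character w.2 z.1)) (tfShift (z + w) f),
    (measurePreserving_sub_right volume z.1).quasiMeasurePreserving.ae (coeFn_tfShift w f)]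
    with t h1 h2 h3 h4
  rw [h1, h3, Pi.smul_apply, h2, h4, character_sub_right, Prod.snd_add, Prod.fst_add,
    character_add_left, smul_eq_mul, sub_sub]
  ring

theorem tfShift_zero (f : L2 d) : tfShift 0 f = f := by
  refine Lp.ext ?_
  filter_upwards [coeFn_tfShift 0 f] with t h
  simp [h, character]

theorem tfShift_smul (z : E d × E d) (c : ℂ) (f : L2 d) : tfShift z (c • f) = c • tfShift z f := by
  refine Lp.ext ?_
  filter_upwards [coeFn_tfShift z f, coeFn_tfShift z (c • f), Lp.coeFn_smul c (tfShift z f),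
    (measurePreserving_sub_right volume z.1).quasiMeasurePreserving.ae (Lp.coeFn_smul c f)]
    with t h1 h2 h3 h4
  rw [h2, h3, Pi.smul_apply, h1, h4, Pi.smul_apply, smul_eq_mul, smul_eq_mul]
  ring

theorem tfShift_surjective (z : E d × E d) : Function.Surjective (tfShift (d := d) z) := by
  intro f
  refine ⟨character (-z).2 z.1 • tfShift (-z) f, ?_⟩
  rw [tfShift_smul, tfShift_tfShift, add_neg_cancel, tfShift_zero, smul_smul, character_mul_conj,
    one_smul]

/-! ### The lattice and the tiling of space by cubes -/

/-- The point `(a k, b l)` of the lattice `aℤ^d × bℤ^d`. -/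
noncomputable def latticePoint (a b : ℝ) (p : (Fin d → ℤ) × (Fin d → ℤ)) : E d × E d :=
  (WithLp.toLp 2 fun i => a * p.1 i, WithLp.toLp 2 fun i => b * p.2 i)

theorem latticePoint_add (a b : ℝ) (p q : (Fin d → ℤ) × (Fin d → ℤ)) :
    latticePoint a b (p + q) = latticePoint a b p + latticePoint a b q := by
  ext i <;> simp [latticePoint, mul_add]

/-- The parametrization of the lattice `aℤ^d × bℤ^d` by pairs of integer vectors. -/
noncomputable def latticeEquiv {a b : ℝ} (ha : a ≠ 0) (hb : b ≠ 0) :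
    (Fin d → ℤ) × (Fin d → ℤ) ≃ lattice d a b :=
  Equiv.ofBijective (fun p => ⟨latticePoint a b p, p.1, p.2, fun _ => ⟨rfl, rfl⟩⟩) <| by
    constructor
    · rintro ⟨k, l⟩ ⟨k', l'⟩ h
      have h' := Subtype.ext_iff.1 h
      simp only [latticePoint, Prod.mk.injEq] at h'
      ext i
      · have := congrArg (fun v : E d => v i) h'.1
        simpa [ha] using this
      · have := congrArg (fun v : E d => v i) h'.2
        simpa [hb] using this
    · rintro ⟨z, k, l, h⟩
      refine ⟨(k, l), Subtype.ext ?_⟩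
      ext i
      · exact (h i).1.symm
      · exact (h i).2.symm

theorem coe_latticeEquiv {a b : ℝ} (ha : a ≠ 0) (hb : b ≠ 0) (p : (Fin d → ℤ) × (Fin d → ℤ)) :
    (latticeEquiv ha hb p : E d × E d) = latticePoint a b p := rfl

/-- The half-open cube `(0, r]^d`. -/
def cube (d : ℕ) (r : ℝ) : Set (E d) := {t | ∀ i, t i ∈ Set.Ioc 0 r}

theorem cube_eq_preimage (r : ℝ) :
    cube d r = WithLp.ofLp ⁻¹' Set.univ.pi fun _ : Fin d => Set.Ioc (0 : ℝ) r := by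
  ext t; simp [cube]

theorem measurableSet_cube (r : ℝ) : MeasurableSet (cube d r) := by
  rw [cube_eq_preimage]
  exact (PiLp.volume_preserving_ofLp (Fin d)).measurable
    (MeasurableSet.univ_pi fun _ => measurableSet_Ioc)

theorem volume_cube (r : ℝ) : volume (cube d r) = ENNReal.ofReal r ^ d := by
  rw [cube_eq_preimage, (PiLp.volume_preserving_ofLp (Fin d)).measure_preimage
    (MeasurableSet.univ_pi fun _ => measurableSet_Ioc).nullMeasurableSet, volume_pi_pi]
  simp

theorem cube_mono {r s : ℝ} (h : r ≤ s) : cube d r ⊆ cube d s :=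
  fun _ ht i => ⟨(ht i).1, (ht i).2.trans h⟩

/-- The translates of `(0, a]^d` by `aℤ^d` tile `ℝ^d`. -/
theorem hasSum_integral_cube_translate {a : ℝ} (ha : 0 < a) {F : E d → ℂ}
    (hF : Integrable F) :
    HasSum (fun k : Fin d → ℤ => ∫ t in cube d a, F (t - WithLp.toLp 2 fun i => a * k i))
      (∫ t, F t) := by
  set v : (Fin d → ℤ) → E d := fun k => WithLp.toLp 2 fun i => a * k i
  -- Half-open intervals make the tiling exact, coordinate by coordinate.
  have huniq : ∀ t : E d, ∃! k : Fin d → ℤ, t + v k ∈ cube d a := fun t => by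
    have h := fun i => existsUnique_add_zsmul_mem_Ioc ha (t i) 0
    choose k hk hk' using h
    refine ⟨k, fun i => ?_, fun l hl => funext fun i => hk' i _ ?_⟩
    · simpa [v, mul_comm] using hk i
    · simpa [v, mul_comm] using hl i
  have hm : ∀ k, MeasurableSet ((fun t => t + v k) ⁻¹' cube d a) := fun k =>
    (measurable_add_const (v k)) (measurableSet_cube a)
  have hU : ⋃ k, (fun t => t + v k) ⁻¹' cube d a = Set.univ := by
    refine Set.eq_univ_of_forall fun t => ?_
    obtain ⟨k, hk, -⟩ := huniq t
    exact Set.mem_iUnion.2 ⟨k, hk⟩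
  have h := hasSum_integral_iUnion (f := F) hm (fun k l hkl => Set.disjoint_left.2
    fun t hk hl => hkl ((huniq t).unique hk hl)) hF.integrableOn
  rw [hU, setIntegral_univ] at h
  refine h.congr_fun fun k => ?_
  rw [← (measurePreserving_sub_right volume (v k)).setIntegral_preimage_emb
    (measurableEmbedding_subRight (v k)) F ((fun t => t + v k) ⁻¹' cube d a)]
  congr 2
  ext t
  simp

/-! ### Parseval's identity on a cube, transported from the torus -/

section Parseval

open UnitAddTorus

/-- The normalized Haar measure, as in Mathlib's theory of multivariate Fourier series. -/
noncomputable local instance : MeasureSpace UnitAddCircle := ⟨AddCircle.haarAddCircle⟩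

/-- The map from the torus to the cube `(0, b⁻¹]^d` in `ℝ^d`. -/
noncomputable def torusToCube (b : ℝ) (x : UnitAddTorus (Fin d)) : E d :=
  b⁻¹ • WithLp.toLp 2 ((measurableEquivPiIoc (0 : Fin d → ℝ) x : Fin d → ℝ))

theorem measurable_torusToCube (b : ℝ) : Measurable (torusToCube (d := d) b) :=
  ((PiLp.volume_preserving_toLp (Fin d)).measurable.comp
    (measurable_subtype_coe.comp (measurableEquivPiIoc _).measurable)).const_smul b⁻¹

/-- The torus has mass `1` and the cube volume `b^{-d}`, whence the density `b^d`. -/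
theorem map_torusToCube {b : ℝ} (hb : 0 < b) :
    (volume : Measure (UnitAddTorus (Fin d))).map (torusToCube b) =
      ENNReal.ofReal (b ^ d) • (volume : Measure (E d)).restrict (cube d b⁻¹) := by
  have hcube : (WithLp.toLp 2 : (Fin d → ℝ) → E d) ⁻¹' cube d 1 =
      {x | ∀ i, x i ∈ Set.Ioc ((0 : Fin d → ℝ) i) ((0 : Fin d → ℝ) i + 1)} := by
    ext t; simp [cube]
  have hmc : MeasurableSet
      {x : Fin d → ℝ | ∀ i, x i ∈ Set.Ioc ((0 : Fin d → ℝ) i) ((0 : Fin d → ℝ) i + 1)} :=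
    hcube ▸ (PiLp.volume_preserving_toLp (Fin d)).measurable (measurableSet_cube 1)
  have h1 : (volume : Measure (UnitAddTorus (Fin d))).map
      (fun x => (measurableEquivPiIoc (0 : Fin d → ℝ) x : Fin d → ℝ)) = volume.restrict
      {x | ∀ i, x i ∈ Set.Ioc ((0 : Fin d → ℝ) i) ((0 : Fin d → ℝ) i + 1)} := by
    refine Eq.trans ?_ (map_comap_subtype_coe hmc volume)
    exact (Measure.map_map measurable_subtype_coe (measurableEquivPiIoc _).measurable).symm.trans
      (congrArg _ (measurePreserving_equivPiIoc (0 : Fin d → ℝ)).map_eq)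
  have hm1 : Measurable (fun x => (measurableEquivPiIoc (0 : Fin d → ℝ) x : Fin d → ℝ)) :=
    measurable_subtype_coe.comp (measurableEquivPiIoc _).measurable
  have h2 : (volume : Measure (UnitAddTorus (Fin d))).map
      (fun x => (WithLp.toLp 2 (measurableEquivPiIoc (0 : Fin d → ℝ) x : Fin d → ℝ) : E d)) =
        volume.restrict (cube d 1) := by
    have h := (PiLp.volume_preserving_toLp (Fin d)).restrict_preimage (measurableSet_cube 1)
    rw [hcube] at h
    rw [← h.map_eq, ← h1, Measure.map_map h.measurable hm1]
    rfl
  have hsm : Measurable fun t : E d => b⁻¹ • t := measurable_id.const_smul b⁻¹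
  have hcube' : cube d 1 = (fun t : E d => b⁻¹ • t) ⁻¹' cube d b⁻¹ := by
    ext t
    simp [cube, hb]
  have h3 : ((volume : Measure (E d)).restrict (cube d 1)).map (fun t => b⁻¹ • t) =
      ENNReal.ofReal (b ^ d) • (volume : Measure (E d)).restrict (cube d b⁻¹) := by
    rw [hcube', ← Measure.restrict_map hsm (measurableSet_cube _),
      Measure.map_addHaar_smul volume (inv_ne_zero hb.ne'), Measure.restrict_smul]
    simp [abs_of_pos hb]
  rw [← h3, ← h2]
  exact (Measure.map_map hsm ((PiLp.volume_preserving_toLp (Fin d)).measurable.comp hm1)).symm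

theorem mFourier_eq_character {b : ℝ} (hb : 0 < b) (l : Fin d → ℤ) (x : UnitAddTorus (Fin d)) :
    mFourier l x = character (WithLp.toLp 2 fun i => b * l i) (torusToCube b x) := by
  obtain ⟨y, rfl⟩ := (measurableEquivPiIoc (0 : Fin d → ℝ)).symm.surjective x
  rw [torusToCube, MeasurableEquiv.apply_symm_apply, coe_symm_measurableEquivPiIoc_apply]
  simp only [mFourier, ContinuousMap.coe_mk, fourier_coe_apply, character, ← Complex.exp_sum]
  congr 1
  simp only [PiLp.inner_apply, RCLike.inner_apply, conj_trivial]
  push_cast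
  rw [Finset.mul_sum]
  refine Finset.sum_congr rfl fun i _ => ?_
  have : (b : ℂ) ≠ 0 := by exact_mod_cast hb.ne'
  simp only [PiLp.smul_apply, smul_eq_mul]
  push_cast
  field_simp

/-- Parseval's identity for the exponentials `e^{2πi b l·t}`, `l ∈ ℤ^d`, on `(0, b⁻¹]^d`. -/
theorem hasSum_inner_character {b : ℝ} (hb : 0 < b) {u v : E d → ℂ}
    (hu : MemLp u 2 (volume.restrict (cube d b⁻¹)))
    (hv : MemLp v 2 (volume.restrict (cube d b⁻¹))) :
    HasSum (fun l : Fin d → ℤ =>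
        conj (∫ t in cube d b⁻¹, conj (character (WithLp.toLp 2 fun i => b * l i) t) * u t) *
          ∫ t in cube d b⁻¹, conj (character (WithLp.toLp 2 fun i => b * l i) t) * v t)
      (((b : ℂ) ^ d)⁻¹ * ∫ t in cube d b⁻¹, conj (u t) * v t) := by
  have hb' : (b : ℂ) ≠ 0 := by exact_mod_cast hb.ne'
  have hmem : ∀ w : E d → ℂ, MemLp w 2 (volume.restrict (cube d b⁻¹)) →
      MemLp (w ∘ torusToCube b) 2 (volume : Measure (UnitAddTorus (Fin d))) := fun w hw => by
    have h : MemLp w 2 ((volume : Measure (UnitAddTorus (Fin d))).map (torusToCube b)) := by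
      rw [map_torusToCube hb]
      exact hw.smul_measure ENNReal.ofReal_ne_top
    exact h.comp_of_map (measurable_torusToCube b).aemeasurable
  have hint : ∀ G : E d → ℂ, AEStronglyMeasurable G (volume.restrict (cube d b⁻¹)) →
      ∫ x : UnitAddTorus (Fin d), G (torusToCube b x) =
        (b : ℂ) ^ d * ∫ t in cube d b⁻¹, G t := fun G hG => by
    rw [← integral_map (measurable_torusToCube b).aemeasurable, map_torusToCube hb,
      integral_smul_measure, ENNReal.toReal_ofReal (by positivity)]
    · simp
    · rw [map_torusToCube hb]
      exact hG.smul_measure _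
  have hχ : ∀ l : Fin d → ℤ, Continuous fun t : E d =>
      conj (character (WithLp.toLp 2 fun i => b * l i) t) := fun l =>
    Complex.continuous_conj.comp (by unfold character; fun_prop)
  have hcoef : ∀ (w : E d → ℂ) (hw : MemLp w 2 (volume.restrict (cube d b⁻¹))) (l : Fin d → ℤ),
      mFourierCoeff ((hmem w hw).toLp _) l = (b : ℂ) ^ d * ∫ t in cube d b⁻¹,
        conj (character (WithLp.toLp 2 fun i => b * l i) t) * w t := fun w hw l => by
    refine Eq.trans ?_ (hint _ ((hχ l).aestronglyMeasurable.mul hw.1))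
    refine integral_congr_ae ?_
    filter_upwards [(hmem w hw).coeFn_toLp] with x hx
    rw [hx, mFourier_neg, mFourier_eq_character hb]
    rfl
  have key := hasSum_prod_mFourierCoeff ((hmem u hu).toLp _) ((hmem v hv).toLp _)
  have hr : ∫ x, conj ((hmem u hu).toLp _ x) * (hmem v hv).toLp _ x =
      (b : ℂ) ^ d * ∫ t in cube d b⁻¹, conj (u t) * v t := by
    refine Eq.trans ?_ (hint _ ((Complex.continuous_conj.comp_aestronglyMeasurable hu.1).mul hv.1))
    refine integral_congr_ae ?_
    filter_upwards [(hmem u hu).coeFn_toLp, (hmem v hv).coeFn_toLp] with x h1 h2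
    rw [h1, h2]
    rfl
  rw [hr] at key
  -- The two Fourier coefficients carry `b^{2d}` and the integral `b^d`; dividing by `b^{2d}` leaves
  -- `b^{-d}`.
  convert! key.mul_left (((b : ℂ) ^ d)⁻¹ ^ 2) using 1
  · funext l
    rw [hcoef u hu, hcoef v hv]
    simp only [map_mul, map_pow, Complex.conj_ofReal]
    field_simp
  · field_simp

end Parseval

/-! ### The inner product of dual windows -/

/-- The indicator function of the cube `(0, r]^d` in `L²`. -/
noncomputable def cubeIndicator (d : ℕ) (r : ℝ) : L2 d :=
  indicatorConstLp 2 (measurableSet_cube (d := d) r)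
    (by rw [volume_cube]; exact ENNReal.pow_ne_top ENNReal.ofReal_ne_top) (1 : ℂ)

theorem inner_cubeIndicator_self {r : ℝ} (hr : 0 ≤ r) :
    ⟪cubeIndicator d r, cubeIndicator d r⟫_ℂ = (r : ℂ) ^ d := by
  rw [cubeIndicator, L2.inner_indicatorConstLp_one, setIntegral_congr_ae (g := fun _ => (1 : ℂ))
    (measurableSet_cube r)]
  · simp [Measure.real, volume_cube, ENNReal.toReal_ofReal hr]
  · filter_upwards [indicatorConstLp_coeFn_mem (p := 2) (hs := measurableSet_cube (d := d) r)
      (hμs := by rw [volume_cube]; exact ENNReal.pow_ne_top ENNReal.ofReal_ne_top)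
      (c := (1 : ℂ))] with t ht using ht

/-- The window of a time-frequency shift, cut off to the cube `(0, a]^d`. -/
noncomputable def cutWindow (a : ℝ) (g : L2 d) (x : E d) : E d → ℂ :=
  (cube d a).indicator fun t => conj (g (t - x))

theorem memLp_cutWindow (a : ℝ) (g : L2 d) (x : E d) : MemLp (cutWindow a g x) 2 volume :=
  ((Lp.memLp g).comp_measurePreserving (measurePreserving_sub_right volume x)).star.indicator
    (measurableSet_cube a)

/-- Enlarging the domain costs nothing, as the cut window vanishes off `(0, a]^d`. With `b⁻¹` in
place of `b`, the right side is a coefficient in `hasSum_inner_character`. -/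
theorem inner_tfShift_cubeIndicator {a b : ℝ} (hab : a ≤ b) (g : L2 d) (x ξ : E d) :
    ⟪tfShift (x, ξ) g, cubeIndicator d a⟫_ℂ =
      ∫ t in cube d b, conj (character ξ t) * cutWindow a g x t := by
  rw [← inner_conj_symm, cubeIndicator, L2.inner_indicatorConstLp_one, ← integral_conj]
  have h : ∀ t, conj (character ξ t) * cutWindow a g x t =
      (cube d a).indicator (fun t => conj (character ξ t) * conj (g (t - x))) t := fun t => by
    by_cases ht : t ∈ cube d a <;> simp [cutWindow, ht]
  simp only [h]
  rw [setIntegral_indicator (measurableSet_cube a), Set.inter_eq_right.2 (cube_mono hab)]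
  refine setIntegral_congr_ae (measurableSet_cube a) ?_
  filter_upwards [coeFn_tfShift (x, ξ) g] with t ht _
  rw [ht, map_mul]

/-- If `g` and `γ` are dual windows for the lattice `aℤ^d × bℤ^d`, `ab ≤ 1`, then
`⟨g, γ⟩ = (ab)^d`. -/
theorem inner_dual_window {a b : ℝ} (ha : 0 < a) (hb : 0 < b) (hab : a * b ≤ 1) {g γ : L2 d}
    (h : ∀ x y, HasSum (fun p : (Fin d → ℤ) × (Fin d → ℤ) =>
      ⟪x, tfShift (latticePoint a b p) g⟫_ℂ * ⟪tfShift (latticePoint a b p) γ, y⟫_ℂ) ⟪x, y⟫_ℂ) :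
    ⟪γ, g⟫_ℂ = ((a : ℂ) * b) ^ d := by
  have hb' : (b : ℂ) ≠ 0 := by exact_mod_cast hb.ne'
  have hab' : a ≤ b⁻¹ := by rwa [← one_div, le_div_iff₀ hb]
  have hfiber : ∀ k : Fin d → ℤ, HasSum (fun l : Fin d → ℤ =>
      ⟪cubeIndicator d a, tfShift (latticePoint a b (k, l)) g⟫_ℂ *
        ⟪tfShift (latticePoint a b (k, l)) γ, cubeIndicator d a⟫_ℂ)
      (((b : ℂ) ^ d)⁻¹ * ∫ t in cube d a,
        ⟪γ (t - WithLp.toLp 2 fun i => a * k i), g (t - WithLp.toLp 2 fun i => a * k i)⟫_ℂ) := by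
    intro k
    set x : E d := WithLp.toLp 2 fun i => a * k i
    have h1 := hasSum_inner_character hb ((memLp_cutWindow a g x).restrict _)
      ((memLp_cutWindow a γ x).restrict _)
    convert! h1 using 1
    · funext l
      rw [← inner_conj_symm, ← inner_tfShift_cubeIndicator hab', ← inner_tfShift_cubeIndicator hab']
      rfl
    · have h2 : ∀ t, conj (cutWindow a g x t) * cutWindow a γ x t =
          (cube d a).indicator (fun t => ⟪γ (t - x), g (t - x)⟫_ℂ) t := fun t => by
        by_cases ht : t ∈ cube d a <;> simp [cutWindow, ht]
      simp only [h2]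
      rw [setIntegral_indicator (measurableSet_cube a), Set.inter_eq_right.2 (cube_mono hab')]
  -- Summing over modulations first leaves a series over translations, which the tiling evaluates.
  have h1 := (h (cubeIndicator d a) (cubeIndicator d a)).prod_fiberwise hfiber
  have h2 := (hasSum_integral_cube_translate ha (L2.integrable_inner (𝕜 := ℂ) γ g)).mul_left
    (((b : ℂ) ^ d)⁻¹)
  have h3 := h1.unique h2
  rw [inner_cubeIndicator_self ha.le, ← L2.inner_def] at h3
  rw [mul_pow, h3]
  field_simp

/-! ### Gabor frames with diagonal channel matrix -/

theorem IsGaborFrame.exists_bounds {a b : ℝ} (ha : a ≠ 0) (hb : b ≠ 0) {g : L2 d}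
    (hg : IsGaborFrame a b g) : ∃ A B : ℝ, 0 < A ∧ ∀ f : L2 d,
      (Summable fun p => ‖⟪tfShift (latticePoint a b p) g, f⟫_ℂ‖ ^ 2) ∧
      A * ‖f‖ ^ 2 ≤ ∑' p, ‖⟪tfShift (latticePoint a b p) g, f⟫_ℂ‖ ^ 2 ∧
      ∑' p, ‖⟪tfShift (latticePoint a b p) g, f⟫_ℂ‖ ^ 2 ≤ B * ‖f‖ ^ 2 := by
  obtain ⟨A, B, hA, -, h⟩ := hg
  refine ⟨A, B, hA, fun f => ?_⟩
  have ht := (latticeEquiv ha hb).tsum_eq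
    fun μ : lattice d a b => ‖⟪tfShift (μ : E d × E d) g, f⟫_ℂ‖ ^ 2
  simp only [coe_latticeEquiv] at ht
  rw [ht]
  exact ⟨(latticeEquiv ha hb).summable_iff.2 (h f).1, (h f).2⟩

theorem eq_zero_of_channelMatrix_isDiag (hd : 0 < d) {a b : ℝ} (ha : 0 < a) (hb : 0 < b)
    (hab : a * b < 1) {T : L2 d →L[ℂ] L2 d} {g : L2 d} (hg : IsGaborFrame a b g)
    (hdiag : (channelMatrix T a b g).IsDiag) : T = 0 := by
  obtain ⟨A, B, hA, h⟩ := hg.exists_bounds ha.ne' hb.ne'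
  obtain ⟨R, hdual, hRsymm, hRcomm⟩ := exists_inverse_frameOperator
    (fun p => tfShift (latticePoint a b p) g) hA (fun f => (h f).1) (fun f => (h f).2.1)
    fun f => (h f).2.2
  -- A lattice shift translates the index set, up to the phase in `tfShift_tfShift`.
  have hRe : ∀ p, R (tfShift (latticePoint a b p) g) = tfShift (latticePoint a b p) (R g) :=
    fun p => hRcomm _ (inner_tfShift_tfShift _) (tfShift_surjective _) (Equiv.addLeft p)
      (fun q => conj (character (latticePoint a b q).2 (latticePoint a b p).1))
      (fun q => by rw [RCLike.norm_conj, norm_character])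
      (fun q => by rw [tfShift_tfShift, ← latticePoint_add]; rfl) g
  -- By `hRe` and symmetry of `R`, the window `R g` is dual to `g`.
  have hgR : ⟪R g, g⟫_ℂ = ((a : ℂ) * b) ^ d := by
    refine inner_dual_window ha hb hab.le fun x y => ?_
    simp only [← hRe, hRsymm]
    exact hdual x y
  have hoff : ∀ p q, p ≠ q →
      ⟪tfShift (latticePoint a b p) g, T (tfShift (latticePoint a b q) g)⟫_ℂ = 0 :=
    fun p q hpq => by
      have h0 := hdiag ((latticeEquiv ha.ne' hb.ne').injective.ne hpq)
      rwa [channelMatrix, Matrix.of_apply, coe_latticeEquiv, coe_latticeEquiv] at h0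
  refine eq_zero_of_frame_matrix_isDiag (e := fun p => tfShift (latticePoint a b p) g) (R := R)
    hA (fun f => (h f).2.1) hdual (fun p => ?_) hoff
  -- Positive dimension matters: for `d = 0` the power would be `1`.
  have hlt : (a * b) ^ d < 1 := pow_lt_one₀ (by positivity) hab hd.ne'
  rw [← hRsymm, hRe, inner_tfShift_tfShift, hgR]
  exact_mod_cast hlt.ne

end Gabor

theorem theorem4 (d : ℕ) (hd : 0 < d) (a b : ℝ) (ha : 0 < a) (hb : 0 < b) (hab : a * b < 1)
    (σ : TemperedDistribution (Gabor.E d × Gabor.E d) ℂ)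
    (T : Gabor.L2 d →L[ℂ] Gabor.L2 d) (hT : Gabor.IsKNOperator σ T)
    (g : Gabor.L2 d) (hg : Gabor.IsGaborFrame a b g)
    (hdiag : (Gabor.channelMatrix T a b g).IsDiag) :
    T = 0 :=
  Gabor.eq_zero_of_channelMatrix_isDiag hd ha hb hab hg hdiag
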